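/- Let $\Pi\subseteq\mathbb{R}$ be the set of admissible broadcast signals, let $N\in\mathbb{N}$ and $r\in\mathbb{R}$. For $i=1,\dots,N$, let agent $i$ have state $x_i(k)\in\mathbb{R}^{n_i}$ and scalar output $y_i(k)$ with $$x_i(k+1)=A_i x_i(k)+b_i(k),\qquad y_i(k)=c_i^T x_i(k)+d_i(k),$$ where $A_i\in\mathbb{R}^{n_i\times n_i}$ is Schur (all complex eigenvalues have modulus $<1$) and, given the past and the current signal $\pi(k)\in\Pi$, all the $b_i(k)$ and $d_i(k)$, $i=1,\dots,N$, are drawn independently from finite families $(b_{ij})_{j=1}^{w_i}\subset\mathbb{R}^{n_i}$ and $(d_{i\ell})_{\ell=1}^{h_i}\subset\mathbb{R}$ with $\mathbb{P}(b_i=b_{ij})=p_{ij}(\pi(k))$ and $\mathbb{P}(d_i=d_{i\ell})=p'_{i\ell}(\pi(k))$ (probabilities attached to the indices $j$, $\ell$), where $p_{ij},p'_{i\ell}:\Pi\to[0,1]$ and $\sum_j p_{ij}=\sum_\ell p'_{i\ell}=1$ on $\Pi$. Let $y(k)=\sum_i y_i(k)$, let the filter be $$x_f(k+1)=A_f x_f(k)+B_f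 y(k),\qquad \hat y(k)=C_f x_f(k),$$ and let the controller be $$x_c(k+1)=A_c x_c(k)+B_c e(k),\qquad \pi(k)=C_c x_c(k)+D_c e(k),\qquad e(k)=r-\hat y(k),$$ with states $x_f(k)\in\mathbb{R}^{n_f}$, $x_c(k)\in\mathbb{R}^{n_c}$ and scalar $y,\hat y,e,\pi$. Then $\xi(k)=((x_i(k))_i,x_f(k),x_c(k))$ is a time-homogeneous Markov chain. Let its state space $\mathbb{X}$ be a non-empty closed set of such states (for instance the whole space if $\Pi=\mathbb{R}$) on which $\pi$ takes values in $\Pi$ and which is mapped into itself by the loop dynamics for every choice of the $b_{ij}$ and $d_{i\ell}$. Assume that all $p_{ij}$ and $p'_{i\ell}$ are Dini continuous on $\Pi$ (that is, the modulus of uniform continuity $\omega$ satisfies $\int_0^\varepsilon \omega(t)\,t^{-1}\,dt<\infty$ for some $\varepsilon>0$), and that there are $\delta,\delta'>0$ with $p_{ij}(\pi)\ge\delta$ and $p'_{i\ell}(\pi)\ge\delta'$ for all $i,j,\ell$ and all $\pi\in\Pi$. Then for every such linear controller with $A_c$ Schur and every such linear filter with $A_f$ Schur, the chain $\xi$ has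 exactly one invariant probability measure $\mu$ on $\mathbb{X}$, and for every initial probability distribution of $\xi(0)$ on $\mathbb{X}$ the distribution of $\xi(k)$ converges weakly to $\mu$ as $k\to\infty$. -/

import Mathlib

open MeasureTheory ProbabilityTheory
open scoped ENNReal Matrix

namespace Ensemble

/-- A real square matrix is Schur if all its complex eigenvalues lie in the open unit disc. -/
def IsSchur {n : ℕ} (A : Matrix (Fin n) (Fin n) ℝ) : Prop :=
  ∀ z ∈ spectrum ℂ (A.map (fun t : ℝ => (t : ℂ))), ‖z‖ < 1

/-- The (extended real) modulus of uniform continuity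
`ω_f(t) = sup { |f x - f y| : |x - y| ≤ t }`. -/
noncomputable def modulus {S : Type*} [PseudoMetricSpace S] (f : S → ℝ) (t : ℝ) : ℝ≥0∞ :=
  ⨆ (x : S) (y : S) (_ : dist x y ≤ t), edist (f x) (f y)

/-- Dini continuity: `ω_f(t) / t` is integrable on some interval `(0, ε)`. -/
def DiniContinuous {S : Type*} [PseudoMetricSpace S] (f : S → ℝ) : Prop :=
  ∃ ε : ℝ, 0 < ε ∧ ∫⁻ t in Set.Ioo 0 ε, modulus f t / ENNReal.ofReal t < ∞

/-- A finite family of probability functions of the broadcast signal: for each admissible signal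
`s`, the numbers `prob j s`, `j = 1, …, w`, are the weights of a probability distribution. -/
structure ProbFunctions (Sig : Set ℝ) (w : ℕ) where
  prob : Fin w → Sig → ℝ
  nonneg : ∀ j s, 0 ≤ prob j s
  sum_eq_one : ∀ s, ∑ j, prob j s = 1
  measurable : ∀ j, Measurable (prob j)

/-- An agent with affine stochastic dynamics `x(k+1) = A x(k) + b`, `y(k) = cᵀ x(k) + d`, where
`b` is one of `b j` (with probability `p.prob j`) and `d` one of `d l` (with probability
`p'.prob l`), the probabilities being evaluated at the current broadcast signal. -/
structure AffineAgent (Sig : Set ℝ) where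
  n : ℕ
  w : ℕ
  h : ℕ
  A : Matrix (Fin n) (Fin n) ℝ
  b : Fin w → Fin n → ℝ
  c : Fin n → ℝ
  d : Fin h → ℝ
  p : ProbFunctions Sig w
  p' : ProbFunctions Sig h

/-- A linear controller `x(k+1) = A x(k) + B e(k)`, `π(k) = C x(k) + D e(k)`. -/
structure LinearController where
  n : ℕ
  A : Matrix (Fin n) (Fin n) ℝ
  B : Fin n → ℝ
  C : Fin n → ℝ
  D : ℝ

/-- A linear filter `x(k+1) = A x(k) + B y(k)`, `ŷ(k) = C x(k)`. -/
structure LinearFilter where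
  n : ℕ
  A : Matrix (Fin n) (Fin n) ℝ
  B : Fin n → ℝ
  C : Fin n → ℝ

/-- The closed loop: `N` agents, a controller, a filter and the reference value `r`. -/
structure FeedbackLoop (Sig : Set ℝ) (N : ℕ) where
  agent : Fin N → AffineAgent Sig
  controller : LinearController
  filter : LinearFilter
  r : ℝ

namespace FeedbackLoop

/-- The overall states `ξ = ((x_i)_i, x_f, x_c)`. -/
abbrev State {Sig : Set ℝ} {N : ℕ} (L : FeedbackLoop Sig N) : Type :=
  (∀ i : Fin N, Fin (L.agent i).n → ℝ) × (Fin L.filter.n → ℝ) × (Fin L.controller.n → ℝ)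

/-- A simultaneous choice of the indices of `b_i` and of `d_i` for all agents `i`. -/
abbrev Choice {Sig : Set ℝ} {N : ℕ} (L : FeedbackLoop Sig N) : Type :=
  (∀ i : Fin N, Fin (L.agent i).w) × (∀ i : Fin N, Fin (L.agent i).h)

/-- The error signal `e = r - ŷ`, with `ŷ = C_f x_f`. -/
def error {Sig : Set ℝ} {N : ℕ} (L : FeedbackLoop Sig N) (ξ : L.State) : ℝ :=
  L.r - L.filter.C ⬝ᵥ ξ.2.1

/-- The broadcast signal `π = C_c x_c + D_c e`. -/
def signal {Sig : Set ℝ} {N : ℕ} (L : FeedbackLoop Sig N) (ξ : L.State) : ℝ :=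
  L.controller.C ⬝ᵥ ξ.2.2 + L.controller.D * L.error ξ

/-- The aggregate utilisation `y = ∑ i, y_i` for a given choice of the `d_i`. -/
def output {Sig : Set ℝ} {N : ℕ} (L : FeedbackLoop Sig N) (m : L.Choice) (ξ : L.State) : ℝ :=
  ∑ i, ((L.agent i).c ⬝ᵥ ξ.1 i + (L.agent i).d (m.2 i))

/-- The successor of the state `ξ` for a given choice of the `b_i` and `d_i`. -/
def step {Sig : Set ℝ} {N : ℕ} (L : FeedbackLoop Sig N) (m : L.Choice) (ξ : L.State) : L.State :=
  (fun i => (L.agent i).A *ᵥ ξ.1 i + (L.agent i).b (m.1 i),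
    L.filter.A *ᵥ ξ.2.1 + L.output m ξ • L.filter.B,
    L.controller.A *ᵥ ξ.2.2 + L.error ξ • L.controller.B)

/-- The probability of a choice at the admissible signal `s`: all draws are independent given
the signal. -/
noncomputable def weight {Sig : Set ℝ} {N : ℕ} (L : FeedbackLoop Sig N) (m : L.Choice)
    (s : Sig) : ℝ :=
  (∏ i, (L.agent i).p.prob (m.1 i) s) * ∏ i, (L.agent i).p'.prob (m.2 i) s

/-- `X` is a state space for the loop: a non-empty closed set of states which the loop never
leaves and on which the controller only broadcasts admissible signals. -/
structure IsStateSpace {Sig : Set ℝ} {N : ℕ} (L : FeedbackLoop Sig N) (X : Set L.State) :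
    Prop where
  nonempty : X.Nonempty
  isClosed : IsClosed X
  signal_mem : ∀ ξ ∈ X, L.signal ξ ∈ Sig
  step_mem : ∀ m, ∀ ξ ∈ X, L.step m ξ ∈ X

theorem sum_weight {Sig : Set ℝ} {N : ℕ} (L : FeedbackLoop Sig N) (s : Sig) :
    ∑ m, L.weight m s = 1 := by
  have h1 : ∑ a : (∀ i : Fin N, Fin (L.agent i).w), ∏ i, (L.agent i).p.prob (a i) s = 1 := by
    rw [← Fintype.prod_sum (fun i j => (L.agent i).p.prob j s)]
    simp [ProbFunctions.sum_eq_one]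
  have h2 : ∑ a : (∀ i : Fin N, Fin (L.agent i).h), ∏ i, (L.agent i).p'.prob (a i) s = 1 := by
    rw [← Fintype.prod_sum (fun i j => (L.agent i).p'.prob j s)]
    simp [ProbFunctions.sum_eq_one]
  simp only [weight, Fintype.sum_prod_type]
  rw [← Finset.sum_mul_sum, h1, h2, one_mul]

theorem weight_nonneg {Sig : Set ℝ} {N : ℕ} (L : FeedbackLoop Sig N) (m : L.Choice) (s : Sig) :
    0 ≤ L.weight m s :=
  mul_nonneg (Finset.prod_nonneg fun _ _ => ProbFunctions.nonneg _ _ _)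
    (Finset.prod_nonneg fun _ _ => ProbFunctions.nonneg _ _ _)

theorem measurable_weight {Sig : Set ℝ} {N : ℕ} (L : FeedbackLoop Sig N) (m : L.Choice) :
    Measurable (L.weight m) :=
  (Finset.measurable_fun_prod _ fun _ _ => ProbFunctions.measurable _ _).mul
    (Finset.measurable_fun_prod _ fun _ _ => ProbFunctions.measurable _ _)

theorem measurable_signal {Sig : Set ℝ} {N : ℕ} (L : FeedbackLoop Sig N) :
    Measurable L.signal := by
  have : Continuous L.signal := by
    unfold signal error dotProduct
    fun_prop
  exact this.measurable

/-- The one-step transition probability of the Markov chain of overall states on `X`: from `ξ`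
the loop moves to `step m ξ` with probability `weight m (π(ξ))`. -/
noncomputable def transition {Sig : Set ℝ} {N : ℕ} (L : FeedbackLoop Sig N) {X : Set L.State}
    (hX : L.IsStateSpace X) : Kernel X X where
  toFun ξ := ∑ m : L.Choice,
    ENNReal.ofReal (L.weight m ⟨L.signal ξ, hX.signal_mem ξ ξ.2⟩) •
      Measure.dirac (⟨L.step m ξ, hX.step_mem m ξ ξ.2⟩ : X)
  measurable' := by
    have hs : ∀ m : L.Choice,
        Measurable fun ξ : X => (⟨L.step m ξ, hX.step_mem m ξ ξ.2⟩ : X) := by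
      intro m
      have : Continuous (L.step m) := by
        unfold step output error dotProduct
        fun_prop
      exact (this.measurable.comp measurable_subtype_coe).subtype_mk
    have hw : ∀ m : L.Choice, Measurable fun ξ : X =>
        ENNReal.ofReal (L.weight m ⟨L.signal ξ, hX.signal_mem ξ ξ.2⟩) := fun m =>
      ((L.measurable_weight m).comp
        (L.measurable_signal.comp measurable_subtype_coe).subtype_mk).ennreal_ofReal
    refine Measure.measurable_of_measurable_coe _ fun G hG => ?_
    simp only [Measure.coe_finsetSum, Finset.sum_apply, Measure.smul_apply, smul_eq_mul]
    exact Finset.measurable_fun_sum _ fun m _ =>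
      (hw m).mul ((Measure.measurable_coe hG).comp (Measure.measurable_dirac.comp (hs m)))

instance isMarkovKernel_transition {Sig : Set ℝ} {N : ℕ} (L : FeedbackLoop Sig N)
    {X : Set L.State} (hX : L.IsStateSpace X) : IsMarkovKernel (L.transition hX) where
  isProbabilityMeasure ξ := ⟨by
    simp only [transition, Kernel.coe_mk, Measure.coe_finsetSum, Finset.sum_apply,
      Measure.smul_apply, measure_univ, smul_eq_mul, mul_one]
    rw [← ENNReal.ofReal_sum_of_nonneg fun m _ => L.weight_nonneg m _, L.sum_weight,
      ENNReal.ofReal_one]⟩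

end FeedbackLoop

/-- The law at time `k` of a Markov chain with transition kernel `κ` and initial law `ν`:
`λ_{k+1}(G) = ∫ κ(x, G) dλ_k(x)`. -/
noncomputable def lawAt {E : Type*} [MeasurableSpace E] (κ : Kernel E E) [IsMarkovKernel κ]
    (ν : ProbabilityMeasure E) : ℕ → ProbabilityMeasure E
  | 0 => ν
  | k + 1 => ⟨(lawAt κ ν k : Measure E).bind κ, inferInstance⟩

end Ensemble

namespace Ensemble

open Filter Topology BoundedContinuousFunction

/-! The drawn indices only add a constant to the state, so on `X` the loop is an iterated function
system of affine maps sharing one linear part, with place-dependent probabilities. That linear part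
is a cascade: agents drive the filter, the filter drives the controller, and feedback to the agents
acts only through the probabilities. Three Schur blocks therefore make its powers decay
geometrically, whatever the gains (`summable_norm_linearPart_pow`).

Two copies of the chain that use the same indices approach each other geometrically. Since the
weights are bounded below and their moduli are summable along geometric sequences
(`DiniContinuous.summable_modulus`), the copies can share all indices forever with probability
bounded below, and close to one if they start close. A failed attempt costs at most the oscillation
over a compact forward invariant set, so repeated attempts drive the oscillation of the iterates of
`markovOp` to zero (`markovOp_iterate_osc_tendsto`). The coupling is never constructed; it appears
only as inequalities.

Tightness then gives a limit point of the laws from one starting state, and forgetting of the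
initial state makes it invariant and globally attractive (`exists_unique_invariant_of_forget`). -/

/-! ### Lower bounds for products with summable defects. -/

theorem one_sub_sum_le_prod {a : ℕ → ℝ} (h0 : ∀ j, 0 ≤ a j) (h1 : ∀ j, a j ≤ 1) (n : ℕ) :
    1 - ∑ j ∈ Finset.range n, (1 - a j) ≤ ∏ j ∈ Finset.range n, a j := by
  induction n with
  | zero => simp
  | succ n ih =>
    rw [Finset.sum_range_succ, Finset.prod_range_succ]
    have hp : ∏ j ∈ Finset.range n, a j ≤ 1 := Finset.prod_le_one (fun _ _ => h0 _) fun _ _ => h1 _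
    nlinarith [h1 n, h0 n]

theorem eventually_one_sub_le_prod {a : ℕ → ℝ} (h0 : ∀ j, 0 ≤ a j) (h1 : ∀ j, a j ≤ 1)
    (hs : Summable fun j => 1 - a j) {ε : ℝ} (hε : 0 < ε) :
    ∀ᶠ k in atTop, ∀ n, 1 - ε ≤ ∏ j ∈ Finset.range n, a (k + j) := by
  have ht := tendsto_sum_nat_add fun j => 1 - a j
  filter_upwards [ht.eventually (gt_mem_nhds hε)] with k hk n
  have hsk : Summable fun j => 1 - a (j + k) := (summable_nat_add_iff k).2 hs
  have h2 := hsk.sum_le_tsum (Finset.range n) fun j _ => sub_nonneg.2 (h1 _)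
  have h3 := one_sub_sum_le_prod (fun j => h0 (k + j)) (fun j => h1 (k + j)) n
  simp only [add_comm _ k] at h2 hk
  linarith

theorem exists_pos_le_prod {a : ℕ → ℝ} {κ : ℝ} (hκ : 0 < κ) (h0 : ∀ j, κ ≤ a j)
    (h1 : ∀ j, a j ≤ 1) (hs : Summable fun j => 1 - a j) :
    ∃ c, 0 < c ∧ ∀ n, c ≤ ∏ j ∈ Finset.range n, a j := by
  have h0' : ∀ j, 0 ≤ a j := fun j => hκ.le.trans (h0 j)
  obtain ⟨k, hk⟩ := (eventually_one_sub_le_prod h0' h1 hs (ε := 1 / 2) (by norm_num)).exists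
  -- The first `k` factors are each at least `κ`; all later ones together contribute at least `1 /
  -- 2`.
  refine ⟨κ ^ k * (1 / 2), by positivity, fun n => ?_⟩
  have hk' : κ ^ k ≤ ∏ j ∈ Finset.range k, a j := by
    simpa using Finset.prod_le_prod (s := Finset.range k) (fun _ _ => hκ.le) fun j _ => h0 j
  calc κ ^ k * (1 / 2) ≤ (∏ j ∈ Finset.range k, a j) * ∏ j ∈ Finset.range n, a (k + j) := by
        have := hk n
        exact mul_le_mul hk' (by linarith) (by norm_num) (Finset.prod_nonneg fun _ _ => h0' _)
    _ = ∏ j ∈ Finset.range (k + n), a j := (Finset.prod_range_add _ _ _).symm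
    _ ≤ ∏ j ∈ Finset.range n, a j := by
        rw [add_comm, Finset.prod_range_add]
        exact mul_le_of_le_one_right (Finset.prod_nonneg fun _ _ => h0' _)
          (Finset.prod_le_one (fun _ _ => h0' _) fun _ _ => h1 _)

/-! ### Oscillation of the iterated transition operator. -/

/-- The operator `f ↦ ∑ m, q m · f ∘ g m` of the iterated function system with maps `g m` chosen
with place dependent probabilities `q m`. -/
def markovOp {α ι : Type*} [Fintype ι] (q : ι → α → ℝ) (g : ι → α → α) (f : α → ℝ) (x : α) : ℝ :=
  ∑ m, q m x * f (g m x)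

section Oscillation

variable {α ι : Type*} [Fintype ι] {q : ι → α → ℝ} {g : ι → α → α}
  (hq0 : ∀ m x, 0 ≤ q m x) (hq1 : ∀ x, ∑ m, q m x = 1)
include hq0 hq1

/-- One coupling step: a share `c` of the mass moves both points by the same index and costs `e`;
the remaining share `1 - c` moves them independently and costs `O`. -/
theorem markovOp_sub_le {c : ℝ} {x y : α} (hc : ∀ m, c * q m y ≤ q m x) {f : α → ℝ} {e O : ℝ}
    (he : ∀ m, f (g m x) - f (g m y) ≤ e) (hO : ∀ m m', f (g m x) - f (g m' y) ≤ O)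
    (hc0 : 0 ≤ c) :
    markovOp q g f x - markovOp q g f y ≤ c * e + (1 - c) * O := by
  have key : markovOp q g f x - markovOp q g f y
      = c * ∑ m, q m y * (f (g m x) - f (g m y))
        + (∑ m, (q m x - c * q m y) * f (g m x) - (1 - c) * markovOp q g f y) := by
    simp only [markovOp, mul_sub, sub_mul, Finset.sum_sub_distrib, Finset.mul_sum]
    simp only [one_mul, mul_assoc]
    ring
  have h1 : ∑ m, q m y * (f (g m x) - f (g m y)) ≤ e := by
    calc _ ≤ ∑ m, q m y * e := Finset.sum_le_sum fun m _ =>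
          mul_le_mul_of_nonneg_left (he m) (hq0 m y)
      _ = e := by rw [← Finset.sum_mul, hq1, one_mul]
  have hw : ∑ m, (q m x - c * q m y) = 1 - c := by
    rw [Finset.sum_sub_distrib, ← Finset.mul_sum, hq1, hq1, mul_one]
  have hw0 : 0 ≤ 1 - c := hw ▸ Finset.sum_nonneg fun m _ => sub_nonneg.2 (hc m)
  have h2 : ∀ m, f (g m x) - O ≤ markovOp q g f y := fun m => by
    calc f (g m x) - O = ∑ m', q m' y * (f (g m x) - O) := by rw [← Finset.sum_mul, hq1, one_mul]
      _ ≤ _ := Finset.sum_le_sum fun m' _ =>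
        mul_le_mul_of_nonneg_left (by linarith [hO m m']) (hq0 m' y)
  have h3 : ∑ m, (q m x - c * q m y) * f (g m x) ≤ (1 - c) * (markovOp q g f y + O) := by
    rw [← hw, Finset.sum_mul]
    exact Finset.sum_le_sum fun m _ =>
      mul_le_mul_of_nonneg_left (by linarith [h2 m]) (sub_nonneg.2 (hc m))
  rw [key]
  nlinarith [mul_le_mul_of_nonneg_left h1 hc0]

variable {K : Set α} (hK : ∀ m, ∀ x ∈ K, g m x ∈ K)
include hK

theorem markovOp_iterate_osc_le {f : α → ℝ} {O : ℝ} (hO : ∀ x ∈ K, ∀ y ∈ K, f x - f y ≤ O) (n : ℕ) :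
    ∀ x ∈ K, ∀ y ∈ K, (markovOp q g)^[n] f x - (markovOp q g)^[n] f y ≤ O := by
  induction n with
  | zero => exact hO
  | succ n ih =>
    intro x hx y hy
    rw [Function.iterate_succ_apply']
    have := markovOp_sub_le hq0 hq1 (g := g) (c := 0) (x := x) (y := y)
      (fun m => by simpa using hq0 m x) (f := (markovOp q g)^[n] f) (e := O) (O := O)
      (fun m => ih _ (hK m x hx) _ (hK m y hy))
      (fun m m' => ih _ (hK m x hx) _ (hK m' y hy)) le_rfl
    linarith

variable {P : ℕ → α → α → Prop} (hP : ∀ k x y m, P k x y → P (k + 1) (g m x) (g m y))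
  {a : ℕ → ℝ} (ha0 : ∀ k, 0 ≤ a k) (hqa : ∀ k x y m, P k x y → a k * q m y ≤ q m x)
include hP ha0 hqa

/-- `P k` says that a pair has reached closeness level `k`. A shared index raises the level by one,
and the product is the guaranteed probability of sharing `n` indices in a row. -/
theorem markovOp_iterate_sub_le {f : α → ℝ} {O e : ℝ} (hO : ∀ x ∈ K, ∀ y ∈ K, f x - f y ≤ O)
    (n : ℕ) : ∀ k, (∀ x ∈ K, ∀ y ∈ K, P (k + n) x y → f x - f y ≤ e) →
    ∀ x ∈ K, ∀ y ∈ K, P k x y → (markovOp q g)^[n] f x - (markovOp q g)^[n] f y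
      ≤ (∏ j ∈ Finset.range n, a (k + j)) * e + (1 - ∏ j ∈ Finset.range n, a (k + j)) * O := by
  induction n with
  | zero => intro k he x hx y hy hxy; simpa using he x hx y hy hxy
  | succ n ih =>
    intro k he x hx y hy hxy
    rw [Function.iterate_succ_apply']
    have h1 := ih (k + 1) (fun x hx y hy h => he x hx y hy (by convert h using 1; ring))
    have h2 := markovOp_sub_le hq0 hq1 (g := g) (c := a k) (x := x) (y := y)
      (fun m => hqa k x y m hxy) (f := (markovOp q g)^[n] f)
      (fun m => h1 _ (hK m x hx) _ (hK m y hy) (hP k x y m hxy))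
      (O := O) (fun m m' => markovOp_iterate_osc_le hq0 hq1 hK hO n
        _ (hK m x hx) _ (hK m' y hy)) (ha0 k)
    rw [Finset.prod_range_succ']
    refine h2.trans_eq ?_
    simp only [add_zero, add_assoc, add_comm 1]
    ring

/-- Reaching a high level has probability at least `c`, and from there the iterates differ little,
uniformly in time. Each round thus shrinks the excess oscillation by the factor `1 - c`. -/
theorem markovOp_iterate_osc_tendsto [PseudoMetricSpace α] (hKc : IsCompact K)
    (hP0 : ∀ x ∈ K, ∀ y ∈ K, P 0 x y)
    (hPd : ∀ ε > 0, ∀ᶠ k in atTop, ∀ x y, P k x y → dist x y < ε)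
    {κ : ℝ} (hκ : 0 < κ) (hκa : ∀ k, κ ≤ a k) (ha1 : ∀ k, a k ≤ 1)
    (hs : Summable fun k => 1 - a k) {f : α → ℝ} (hf : Continuous f) {ε : ℝ} (hε : 0 < ε) :
    ∀ᶠ n in atTop, ∀ x ∈ K, ∀ y ∈ K, (markovOp q g)^[n] f x - (markovOp q g)^[n] f y ≤ ε := by
  obtain ⟨M, hM⟩ := (hKc.image hf).isBounded.exists_norm_le
  set B := max (2 * M) 1 with hB
  have hB0 : 0 < B := lt_max_of_lt_right one_pos
  have hfB : ∀ x ∈ K, ∀ y ∈ K, f x - f y ≤ B := fun x hx y hy => by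
    have h1 := hM _ ⟨x, hx, rfl⟩
    have h2 := hM _ ⟨y, hy, rfl⟩
    rw [Real.norm_eq_abs, abs_le] at h1 h2
    exact le_max_of_le_left (by linarith)
  obtain ⟨c, hc0, hc⟩ := exists_pos_le_prod hκ hκa ha1 hs
  have hc1 : c ≤ 1 := by simpa using hc 0
  -- Equicontinuity: from a high level the coupling almost never breaks, and unbroken pairs are
  -- close enough for uniform continuity of `f` on `K`.
  have heq : ∀ η > 0, ∃ k, ∀ n, ∀ x ∈ K, ∀ y ∈ K, P k x y →
      (markovOp q g)^[n] f x - (markovOp q g)^[n] f y ≤ η := by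
    intro η hη
    obtain ⟨s, hs0, hfs⟩ := Metric.uniformContinuousOn_iff.1
      (hKc.uniformContinuousOn_of_continuous hf.continuousOn) (η / 2) (by positivity)
    obtain ⟨k₁, hk₁⟩ := eventually_atTop.1 (hPd s hs0)
    obtain ⟨k₂, hk₂⟩ := eventually_atTop.1
      (eventually_one_sub_le_prod ha0 ha1 hs (ε := η / 2 / B) (by positivity))
    refine ⟨max k₁ k₂, fun n x hx y hy hxy => ?_⟩
    have h1 := markovOp_iterate_sub_le hq0 hq1 hK hP ha0 hqa hfB (e := η / 2) n (max k₁ k₂)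
      (fun x hx y hy h => by
        have := hfs x hx y hy (hk₁ _ (le_add_of_le_left (le_max_left _ _)) x y h)
        rw [Real.dist_eq] at this
        exact (le_abs_self _).trans this.le) x hx y hy hxy
    have h2 := hk₂ (max k₁ k₂) (le_max_right _ _) n
    have h3 : ∏ j ∈ Finset.range n, a (max k₁ k₂ + j) ≤ 1 :=
      Finset.prod_le_one (fun _ _ => ha0 _) fun _ _ => ha1 _
    have h4 : (1 - ∏ j ∈ Finset.range n, a (max k₁ k₂ + j)) * B ≤ η / 2 / B * B :=
      mul_le_mul_of_nonneg_right (by linarith) hB0.le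
    rw [div_mul_cancel₀ _ hB0.ne'] at h4
    have h5 : (∏ j ∈ Finset.range n, a (max k₁ k₂ + j)) * (η / 2) ≤ η / 2 :=
      mul_le_of_le_one_left (by positivity) h3
    linarith
  have hstep : ∀ j : ℕ, ∃ n, ∀ x ∈ K, ∀ y ∈ K,
      (markovOp q g)^[n] f x - (markovOp q g)^[n] f y ≤ ε / 2 + (1 - c) ^ j * B := by
    -- The tolerance `c * (ε / 2)` makes `ε / 2` the fixed point of the recursion `O ↦ c * (ε / 2) +
    -- (1 - c) * O`.
    obtain ⟨k, hk⟩ := heq (c * (ε / 2)) (by positivity)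
    intro j
    induction j with
    | zero => exact ⟨0, fun x hx y hy => by simpa using (hfB x hx y hy).trans (by linarith)⟩
    | succ j ih =>
      obtain ⟨n, hn⟩ := ih
      refine ⟨k + n, fun x hx y hy => ?_⟩
      have h1 := markovOp_iterate_sub_le hq0 hq1 hK hP ha0 hqa hn (e := c * (ε / 2)) k 0
        (fun x hx y hy h => hk n x hx y hy (by simpa using h)) x hx y hy (hP0 x hx y hy)
      rw [← Function.iterate_add_apply] at h1
      refine h1.trans ?_
      have h2 := hc k
      have h3 : ∏ j ∈ Finset.range k, a j ≤ 1 :=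
        Finset.prod_le_one (fun _ _ => ha0 _) fun _ _ => ha1 _
      simp only [zero_add]
      have h4 : (∏ j ∈ Finset.range k, a j) * (c * (ε / 2)) ≤ c * (ε / 2) :=
        mul_le_of_le_one_left (by positivity) h3
      have h5 : (1 - ∏ j ∈ Finset.range k, a j) * (ε / 2 + (1 - c) ^ j * B)
          ≤ (1 - c) * (ε / 2 + (1 - c) ^ j * B) := by
        have : 0 ≤ 1 - c := by linarith
        gcongr
      rw [pow_succ]
      linarith
  have hlim : Tendsto (fun j : ℕ => (1 - c) ^ j * B) atTop (𝓝 0) := by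
    simpa using (tendsto_pow_atTop_nhds_zero_of_lt_one (by linarith) (by linarith)).mul_const B
  obtain ⟨j, hj⟩ := (hlim.eventually (gt_mem_nhds (half_pos hε))).exists
  obtain ⟨n, hn⟩ := hstep j
  filter_upwards [eventually_ge_atTop n] with n' hn' x hx y hy
  obtain ⟨i, rfl⟩ := Nat.exists_eq_add_of_le' hn'
  rw [Function.iterate_add_apply]
  exact (markovOp_iterate_osc_le hq0 hq1 hK hn i x hx y hy).trans (by linarith)

end Oscillation

/-! ### From forgetting the initial state to a unique attractive law. -/

section Kernel

variable {α ι : Type*} [Fintype ι] {q : ι → α → ℝ} {g : ι → α → α}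

theorem abs_markovOp_iterate_le (hq0 : ∀ m x, 0 ≤ q m x) (hq1 : ∀ x, ∑ m, q m x = 1) {f : α → ℝ}
    {M : ℝ} (hf : ∀ x, |f x| ≤ M) (n : ℕ) : ∀ x, |(markovOp q g)^[n] f x| ≤ M := by
  induction n with
  | zero => exact hf
  | succ n ih =>
    intro x
    rw [Function.iterate_succ_apply']
    calc |markovOp q g ((markovOp q g)^[n] f) x|
        ≤ ∑ m, |q m x * (markovOp q g)^[n] f (g m x)| := Finset.abs_sum_le_sum_abs _ _
      _ ≤ ∑ m, q m x * M := Finset.sum_le_sum fun m _ => by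
          rw [abs_mul, abs_of_nonneg (hq0 m x)]
          exact mul_le_mul_of_nonneg_left (ih _) (hq0 m x)
      _ = M := by rw [← Finset.sum_mul, hq1, one_mul]

variable [MetricSpace α]

theorem continuous_markovOp_iterate (hqc : ∀ m, Continuous (q m)) (hgc : ∀ m, Continuous (g m))
    {f : α → ℝ} (hf : Continuous f) (n : ℕ) : Continuous ((markovOp q g)^[n] f) := by
  induction n with
  | zero => exact hf
  | succ n ih =>
    rw [Function.iterate_succ_apply']
    exact continuous_finsetSum _ fun m _ => (hqc m).mul (ih.comp (hgc m))

variable [MeasurableSpace α] [BorelSpace α] {κ : Kernel α α} [IsMarkovKernel κ]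

omit [MetricSpace α] [BorelSpace α] in
theorem lawAt_compl_eq_zero
    (hκ : ∀ x, κ x = ∑ m, ENNReal.ofReal (q m x) • Measure.dirac (g m x)) {K : Set α}
    (hKm : MeasurableSet K) (hK : ∀ m, ∀ x ∈ K, g m x ∈ K) {ν : ProbabilityMeasure α}
    (hν : (ν : Measure α) Kᶜ = 0) (n : ℕ) : (lawAt κ ν n : Measure α) Kᶜ = 0 := by
  induction n with
  | zero => exact hν
  | succ n ih =>
    change ((lawAt κ ν n : Measure α).bind κ) Kᶜ = 0
    rw [Measure.bind_apply hKm.compl κ.aemeasurable,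
      lintegral_eq_zero_iff (κ.measurable_coe hKm.compl)]
    have : ∀ᵐ x ∂(lawAt κ ν n : Measure α), x ∈ K := ih
    filter_upwards [this] with x hx
    simp only [hκ, Measure.coe_finsetSum, Finset.sum_apply, Measure.smul_apply, smul_eq_mul,
      Measure.dirac_apply' _ hKm.compl, Pi.zero_apply]
    exact Finset.sum_eq_zero fun m _ => by simp [hK m x hx]

variable (hκ : ∀ x, κ x = ∑ m, ENNReal.ofReal (q m x) • Measure.dirac (g m x))
  (hq0 : ∀ m x, 0 ≤ q m x) (hq1 : ∀ x, ∑ m, q m x = 1)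
  (hqc : ∀ m, Continuous (q m)) (hgc : ∀ m, Continuous (g m))
include hκ hq0

omit [IsMarkovKernel κ] in
theorem integral_kernel_eq_markovOp {f : α → ℝ} (hf : Continuous f) (x : α) :
    ∫ y, f y ∂κ x = markovOp q g f x := by
  have hi : ∀ m, Integrable f (Measure.dirac (g m x)) := fun m =>
    integrable_dirac' hf.stronglyMeasurable (by simp)
  rw [hκ, integral_finsetSum_measure fun m _ => (hi m).smul_measure ENNReal.ofReal_ne_top]
  refine Finset.sum_congr rfl fun m _ => ?_
  rw [integral_smul_measure, integral_dirac' _ _ hf.stronglyMeasurable,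
    ENNReal.toReal_ofReal (hq0 m x), smul_eq_mul]

theorem integral_bind_eq_markovOp {f : α → ℝ} (hf : Continuous f) {M : ℝ} (hM : ∀ x, |f x| ≤ M)
    (μ : Measure α) [IsProbabilityMeasure μ] :
    ∫ y, f y ∂(μ.bind κ) = ∫ x, markovOp q g f x ∂μ := by
  have hi : Integrable f (μ.bind κ) :=
    Integrable.of_bound hf.aestronglyMeasurable M (Eventually.of_forall hM)
  rw [Measure.comp_eq_comp_const_apply] at hi ⊢
  rw [Kernel.integral_comp hi]
  simp only [Kernel.const_apply]
  exact integral_congr_ae (Eventually.of_forall fun x => integral_kernel_eq_markovOp hκ hq0 hf x)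

include hq1 hqc hgc

theorem integral_lawAt {f : α → ℝ} (hf : Continuous f) {M : ℝ} (hM : ∀ x, |f x| ≤ M)
    (ν : ProbabilityMeasure α) (n : ℕ) :
    ∫ y, f y ∂(lawAt κ ν n : Measure α) = ∫ x, (markovOp q g)^[n] f x ∂(ν : Measure α) := by
  induction n generalizing f with
  | zero => rfl
  | succ n ih =>
    change ∫ y, f y ∂((lawAt κ ν n : Measure α).bind κ) = _
    rw [integral_bind_eq_markovOp hκ hq0 hf hM]
    exact ih (continuous_markovOp_iterate hqc hgc hf 1) (abs_markovOp_iterate_le hq0 hq1 hM 1)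

/-- If the iterates of the transition operator forget the initial point and some compact set is
forward invariant, then the chain has a globally attractive invariant law. -/
theorem exists_unique_invariant_of_forget {K : Set α} (hKc : IsCompact K) (hKne : K.Nonempty)
    (hK : ∀ m, ∀ x ∈ K, g m x ∈ K)
    (hforget : ∀ f : α → ℝ, Continuous f → ∀ x y, Tendsto
      (fun n => (markovOp q g)^[n] f x - (markovOp q g)^[n] f y) atTop (𝓝 0)) :
    ∃ μ : ProbabilityMeasure α, Kernel.Invariant κ (μ : Measure α) ∧
      (∀ μ' : ProbabilityMeasure α, Kernel.Invariant κ (μ' : Measure α) → μ' = μ) ∧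
      ∀ ν : ProbabilityMeasure α, Tendsto (lawAt κ ν) atTop (𝓝 μ) := by
  obtain ⟨x₀, hx₀⟩ := hKne
  have hbd : ∀ f : α →ᵇ ℝ, ∀ x, |f x| ≤ ‖f‖ := fun f x => f.norm_coe_le_norm x
  have hKm : MeasurableSet K := hKc.isClosed.measurableSet
  set ν₀ : ProbabilityMeasure α := ⟨Measure.dirac x₀, inferInstance⟩ with hν₀
  have hlaw₀ : ∀ {f : α → ℝ}, Continuous f → ∀ {M : ℝ}, (∀ x, |f x| ≤ M) → ∀ n,
      ∫ y, f y ∂(lawAt κ ν₀ n : Measure α) = (markovOp q g)^[n] f x₀ := fun hf M hM n => by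
    rw [integral_lawAt hκ hq0 hq1 hqc hgc hf hM]
    exact integral_dirac' _ _ (continuous_markovOp_iterate hqc hgc hf n).stronglyMeasurable
  -- Started in `K`, all laws are carried by `K`, so they are tight and Prokhorov's theorem applies.
  have hcpt : IsCompact (closure (Set.range (lawAt κ ν₀))) := by
    apply isCompact_closure_of_isTightMeasureSet
    rw [isTightMeasureSet_iff_exists_isCompact_measure_compl_le]
    refine fun ε _ => ⟨K, hKc, ?_⟩
    rintro _ ⟨_, ⟨n, rfl⟩, rfl⟩
    refine (lawAt_compl_eq_zero hκ hKm hK ?_ n).le.trans zero_le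
    change Measure.dirac x₀ Kᶜ = 0
    rw [Measure.dirac_apply' _ hKm.compl]
    simp [hx₀]
  let U : Ultrafilter ℕ := Ultrafilter.of atTop
  have hU : (U : Filter ℕ) ≤ atTop := Ultrafilter.of_le _
  obtain ⟨μ, -, hμ⟩ := hcpt.ultrafilter_le_nhds (U.map (lawAt κ ν₀)) (by
    rw [le_principal_iff]
    exact Filter.mem_of_superset (Ultrafilter.mem_map.2 (Filter.univ_mem' Set.mem_range_self))
      subset_closure)
  have hμ' : Tendsto (lawAt κ ν₀) U (𝓝 μ) := hμ
  rw [ProbabilityMeasure.tendsto_iff_forall_integral_tendsto] at hμ'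
  have hlim : ∀ {f : α → ℝ}, Continuous f → ∀ {M : ℝ}, (∀ x, |f x| ≤ M) →
      Tendsto (fun n => (markovOp q g)^[n] f x₀) U (𝓝 (∫ x, f x ∂(μ : Measure α))) := by
    intro f hf M hM
    refine (hμ' (BoundedContinuousFunction.ofNormedAddCommGroup f hf M hM)).congr fun n => ?_
    exact hlaw₀ hf hM n
  have hinv : Kernel.Invariant κ (μ : Measure α) := by
    refine ext_of_forall_integral_eq_of_IsFiniteMeasure fun f => ?_
    rw [integral_bind_eq_markovOp hκ hq0 f.continuous (hbd f)]
    have h1 := hlim f.continuous (hbd f)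
    have h2 := hlim (continuous_markovOp_iterate hqc hgc f.continuous 1)
      (abs_markovOp_iterate_le hq0 hq1 (hbd f) 1)
    -- This sum is the difference of iterates `n + 1` and `n` at `x₀`: one more step only averages
    -- over starting points `g m x₀`, which are forgotten.
    have h3 : Tendsto (fun n => ∑ m, q m x₀ *
        ((markovOp q g)^[n] f (g m x₀) - (markovOp q g)^[n] f x₀)) U (𝓝 0) := by
      have : Tendsto (fun n => ∑ m, q m x₀ *
        ((markovOp q g)^[n] f (g m x₀) - (markovOp q g)^[n] f x₀)) U (𝓝 (∑ m, q m x₀ * 0)) :=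
        tendsto_finsetSum _ fun m _ =>
          ((hforget f f.continuous (g m x₀) x₀).mono_left hU).const_mul _
      simpa using this
    have h4 := h1.add h3
    rw [add_zero] at h4
    refine tendsto_nhds_unique h2 (h4.congr fun n => ?_)
    rw [← Function.iterate_add_apply, add_comm n 1, Function.iterate_add_apply]
    simp only [Function.iterate_one, mul_sub, Finset.sum_sub_distrib, ← Finset.sum_mul, hq1]
    simp [markovOp]
  have hdom : ∀ (f : α →ᵇ ℝ) (ν : ProbabilityMeasure α), Tendsto (fun n =>
      ∫ x, (markovOp q g)^[n] f x ∂(ν : Measure α) - (markovOp q g)^[n] f x₀) atTop (𝓝 0) := by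
    intro f ν
    have hc := continuous_markovOp_iterate hqc hgc f.continuous
    have hb := abs_markovOp_iterate_le (g := g) hq0 hq1 (hbd f)
    have h1 : Tendsto (fun n => ∫ x, ((markovOp q g)^[n] f x - (markovOp q g)^[n] f x₀)
        ∂(ν : Measure α)) atTop (𝓝 (∫ _, (0 : ℝ) ∂(ν : Measure α))) := by
      refine tendsto_integral_of_dominated_convergence (fun _ => ‖f‖ + ‖f‖)
        (fun n => ((hc n).sub continuous_const).aestronglyMeasurable) (integrable_const _)
        (fun n => Eventually.of_forall fun x => ?_)
        (Eventually.of_forall fun x => hforget f f.continuous x x₀)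
      exact (norm_sub_le _ _).trans (add_le_add (hb n x) (hb n x₀))
    rw [integral_zero] at h1
    refine h1.congr fun n => ?_
    rw [integral_sub (Integrable.of_bound (hc n).aestronglyMeasurable ‖f‖
      (Eventually.of_forall (hb n))) (integrable_const _)]
    simp
  have hfix : ∀ μ' : ProbabilityMeasure α, Kernel.Invariant κ (μ' : Measure α) → ∀ n,
      lawAt κ μ' n = μ' := by
    intro μ' h n
    induction n with
    | zero => rfl
    | succ n ih =>
      apply Subtype.ext
      change (lawAt κ μ' n : Measure α).bind κ = μ'
      rw [ih]
      exact h
  have hconv : ∀ ν : ProbabilityMeasure α, Tendsto (lawAt κ ν) atTop (𝓝 μ) := by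
    intro ν
    rw [ProbabilityMeasure.tendsto_iff_forall_integral_tendsto]
    intro f
    have h := (hdom f ν).sub (hdom f μ)
    rw [sub_zero] at h
    have h' := h.add_const (∫ x, f x ∂(μ : Measure α))
    rw [zero_add] at h'
    refine h'.congr fun n => ?_
    rw [← integral_lawAt hκ hq0 hq1 hqc hgc f.continuous (hbd f) ν,
      ← integral_lawAt hκ hq0 hq1 hqc hgc f.continuous (hbd f) μ, hfix μ hinv]
    ring
  refine ⟨μ, hinv, fun μ' h => ?_, hconv⟩
  have := hconv μ'
  rw [funext (hfix μ' h)] at this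
  exact tendsto_nhds_unique tendsto_const_nhds this

end Kernel

/-! ### Affine systems with a common power-decaying linear part. -/

section Contraction

variable {E : Type*} [NormedAddCommGroup E] [NormedSpace ℝ E] {X : Set E} {ι : Type*} [Fintype ι]
  {g : ι → X → X} {Λ : E →L[ℝ] E} {β : ι → E} {C ρ : ℝ}

/-- `K` is a ball of the adapted norm `sup_k ρ ^ (-k) * ‖Λ ^ k z‖`, in which `Λ` contracts by `ρ`.
The summand `M / (1 - ρ)` of the radius absorbs the translations. -/
theorem exists_isCompact_forward_invariant [ProperSpace E] (hX : IsClosed X)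
    (hg : ∀ m x, (g m x : E) = Λ x + β m) (hC : 0 ≤ C) (hρ0 : 0 < ρ) (hρ1 : ρ < 1)
    (hΛ : ∀ k, ‖Λ ^ k‖ ≤ C * ρ ^ k) (x y : X) :
    ∃ (R : ℝ) (K : Set X), 0 ≤ R ∧ IsCompact K ∧ x ∈ K ∧ y ∈ K ∧ (∀ m, ∀ z ∈ K, g m z ∈ K) ∧
      ∀ z ∈ K, ∀ k, ‖(Λ ^ k) z‖ ≤ R * ρ ^ k := by
  have hΛv : ∀ k (v : E), ‖(Λ ^ k) v‖ ≤ C * ‖v‖ * ρ ^ k := fun k v =>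
    ((Λ ^ k).le_of_opNorm_le (hΛ k) v).trans_eq (by ring)
  set M := C * ∑ m, ‖β m‖ with hM
  have hM0 : 0 ≤ M := mul_nonneg hC (Finset.sum_nonneg fun _ _ => norm_nonneg _)
  have hβ : ∀ k m, ‖(Λ ^ k) (β m)‖ ≤ M * ρ ^ k := fun k m => by
    refine (hΛv k (β m)).trans (mul_le_mul_of_nonneg_right ?_ (by positivity))
    exact mul_le_mul_of_nonneg_left
      (Finset.single_le_sum (f := fun m => ‖β m‖) (fun _ _ => norm_nonneg _) (Finset.mem_univ m)) hC
  have hρ' : 0 < 1 - ρ := by linarith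
  set R := C * ‖(x : E)‖ + C * ‖(y : E)‖ + M / (1 - ρ) with hR
  have hx0 : 0 ≤ C * ‖(x : E)‖ := by positivity
  have hy0 : 0 ≤ C * ‖(y : E)‖ := by positivity
  have hMρ : 0 ≤ M / (1 - ρ) := by positivity
  have hRM : R * ρ + M ≤ R := by
    have : M / (1 - ρ) * (1 - ρ) = M := div_mul_cancel₀ _ hρ'.ne'
    nlinarith
  have hR0 : 0 ≤ R := by positivity
  let K' : Set E := ⋂ k, {z | ‖(Λ ^ k) z‖ ≤ R * ρ ^ k}
  have hK'c : IsClosed K' := isClosed_iInter fun k =>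
    isClosed_le (Λ ^ k).continuous.norm continuous_const
  have hK'b : K' ⊆ Metric.closedBall 0 R := fun z hz => by
    have := Set.mem_iInter.1 hz 0
    simpa using this
  have hK' : IsCompact K' := (isCompact_closedBall (0 : E) R).of_isClosed_subset hK'c hK'b
  refine ⟨R, Subtype.val ⁻¹' K', hR0, ?_, ?_, ?_, fun m z hz => ?_, fun z hz k => ?_⟩
  · exact hX.isClosedEmbedding_subtypeVal.isCompact_preimage hK'
  · refine Set.mem_iInter.2 fun k => (hΛv k x).trans ?_
    exact mul_le_mul_of_nonneg_right (by linarith) (by positivity)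
  · refine Set.mem_iInter.2 fun k => (hΛv k y).trans ?_
    exact mul_le_mul_of_nonneg_right (by linarith) (by positivity)
  · refine Set.mem_iInter.2 fun k => ?_
    have h1 : ‖(Λ ^ (k + 1)) z‖ ≤ R * ρ ^ (k + 1) := Set.mem_iInter.1 hz (k + 1)
    calc ‖(Λ ^ k) (g m z)‖ = ‖(Λ ^ (k + 1)) z + (Λ ^ k) (β m)‖ := by
          rw [hg, map_add, pow_succ]; rfl
      _ ≤ R * ρ ^ (k + 1) + M * ρ ^ k := (norm_add_le _ _).trans (add_le_add h1 (hβ k m))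
      _ = (R * ρ + M) * ρ ^ k := by ring
      _ ≤ R * ρ ^ k := mul_le_mul_of_nonneg_right hRM (by positivity)
  · exact Set.mem_iInter.1 hz k

theorem tendsto_markovOp_iterate_sub [ProperSpace E] (hX : IsClosed X)
    (hg : ∀ m x, (g m x : E) = Λ x + β m) (hC : 0 ≤ C) (hρ0 : 0 < ρ) (hρ1 : ρ < 1)
    (hΛ : ∀ k, ‖Λ ^ k‖ ≤ C * ρ ^ k) {q : ι → X → ℝ} {κ : ℝ} (hκ : 0 < κ)
    (hqκ : ∀ m x, κ ≤ q m x) (hq1 : ∀ x, ∑ m, q m x = 1) {φ : ℝ → ℝ}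
    (hφ : ∀ t, 0 ≤ φ t) (hqφ : ∀ m x y t, dist x y ≤ t → |q m x - q m y| ≤ φ t)
    (hφs : ∀ t, 0 ≤ t → Summable fun k : ℕ => φ (t * ρ ^ k)) {f : X → ℝ} (hf : Continuous f)
    (x y : X) :
    Tendsto (fun n => (markovOp q g)^[n] f x - (markovOp q g)^[n] f y) atTop (𝓝 0) := by
  obtain ⟨R, K, hR0, hKc, hxK, hyK, hK, hKR⟩ :=
    exists_isCompact_forward_invariant hX hg hC hρ0 hρ1 hΛ x y
  have hq0 : ∀ m x, 0 ≤ q m x := fun m x => hκ.le.trans (hqκ m x)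
  have hκ1 : κ ≤ 1 := by
    have : Nonempty ι := by
      by_contra h
      rw [not_nonempty_iff] at h
      simpa using hq1 x
    obtain ⟨m⟩ := this
    calc κ ≤ q m x := hqκ m x
      _ ≤ ∑ m, q m x := Finset.single_le_sum (f := fun m => q m x) (fun m _ => hq0 m x)
          (Finset.mem_univ m)
      _ = 1 := hq1 x
  set D := 2 * R with hD
  -- Adapted-norm distance at most `D * ρ ^ k`; testing all powers of `Λ` lets one step gain exactly
  -- one factor `ρ`.
  let P : ℕ → X → X → Prop := fun k x y => ∀ j, ‖(Λ ^ j) ((x : E) - y)‖ ≤ D * ρ ^ (k + j)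
  -- Dividing by `κ` turns the additive modulus into a relative bound on the weights; the maximum
  -- with `κ` keeps the factor positive at low levels.
  let a : ℕ → ℝ := fun k => max κ (1 - φ (D * ρ ^ k) / κ)
  have hPdist : ∀ k x y, P k x y → dist x y ≤ D * ρ ^ k := fun k x y h => by
    simpa [Subtype.dist_eq, dist_eq_norm] using h 0
  have hP : ∀ k x y m, P k x y → P (k + 1) (g m x) (g m y) := fun k x y m h j => by
    have h1 := h (j + 1)
    rw [hg, hg, add_sub_add_right_eq_sub, ← map_sub]
    rw [pow_succ, mul_apply_eq_comp] at h1
    rwa [add_assoc, add_comm 1 j]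
  have hP0 : ∀ x ∈ K, ∀ y ∈ K, P 0 x y := fun x hx y hy j => by
    rw [map_sub, zero_add]
    have := norm_sub_le ((Λ ^ j) (x : E)) ((Λ ^ j) (y : E))
    linarith [hKR x hx j, hKR y hy j]
  have hPd : ∀ ε > 0, ∀ᶠ k in atTop, ∀ x y, P k x y → dist x y < ε := fun ε hε => by
    have : Tendsto (fun k : ℕ => D * ρ ^ k) atTop (𝓝 0) := by
      simpa using (tendsto_pow_atTop_nhds_zero_of_lt_one hρ0.le hρ1).const_mul D
    filter_upwards [this.eventually (gt_mem_nhds hε)] with k hk x y h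
    exact (hPdist k x y h).trans_lt hk
  have hκa : ∀ k, κ ≤ a k := fun k => le_max_left _ _
  have ha1 : ∀ k, a k ≤ 1 := fun k =>
    max_le hκ1 (sub_le_self _ (div_nonneg (hφ _) hκ.le))
  have hs : Summable fun k => 1 - a k := by
    refine Summable.of_nonneg_of_le (fun k => sub_nonneg.2 (ha1 k)) (fun k => ?_)
      ((hφs D (by positivity)).div_const κ)
    have : 1 - φ (D * ρ ^ k) / κ ≤ a k := le_max_right _ _
    linarith
  have hqa : ∀ k x y m, P k x y → a k * q m y ≤ q m x := fun k x y m h => by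
    rw [max_mul_of_nonneg _ _ (hq0 m y)]
    refine max_le ?_ ?_
    · have : q m y ≤ 1 := (hq1 y) ▸ Finset.single_le_sum (f := fun m => q m y)
        (fun m _ => hq0 m y) (Finset.mem_univ m)
      nlinarith [hqκ m x]
    · have h1 := (abs_le.1 (hqφ m x y _ (hPdist k x y h))).1
      have h2 : φ (D * ρ ^ k) ≤ φ (D * ρ ^ k) / κ * q m y := by
        rw [div_mul_eq_mul_div, le_div_iff₀ hκ]
        exact mul_le_mul_of_nonneg_left (hqκ m y) (hφ _)
      linarith
  rw [Metric.tendsto_nhds]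
  intro ε hε
  filter_upwards [markovOp_iterate_osc_tendsto hq0 hq1 hK hP (fun k => hκ.le.trans (hκa k)) hqa
    hKc hP0 hPd hκ hκa ha1 hs hf (half_pos hε)] with n hn
  rw [Real.dist_eq, sub_zero, abs_lt]
  constructor <;> linarith [hn x hxK y hyK, hn y hyK x hxK]

end Contraction

/-! ### Geometric decay of powers and Schur matrices. -/

section PowerDecay

theorem exists_norm_pow_le_geometric_of_tendsto {A : Type*} [NormedRing A] {T : A}
    (h : Tendsto (fun k : ℕ => ‖T ^ k‖) atTop (𝓝 0)) :
    ∃ C ρ : ℝ, 0 ≤ C ∧ 0 < ρ ∧ ρ < 1 ∧ ∀ k, ‖T ^ k‖ ≤ C * ρ ^ k := by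
  obtain ⟨p, hp, hp1⟩ := ((h.eventually (gt_mem_nhds (show (0 : ℝ) < 1 / 2 by norm_num))).and
    (eventually_ge_atTop 1)).exists
  set ρ : ℝ := (1 / 2 : ℝ) ^ ((p : ℝ)⁻¹) with hρ
  have hρp : ρ ^ p = 1 / 2 := Real.rpow_inv_natCast_pow (by norm_num) (by omega)
  have hρ0 : 0 < ρ := by positivity
  have hρ1 : ρ < 1 := Real.rpow_lt_one (by norm_num) (by norm_num) (by positivity)
  set B := ∑ r ∈ Finset.range p, ‖T ^ r‖ with hB
  have hB0 : 0 ≤ B := Finset.sum_nonneg fun _ _ => norm_nonneg _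
  -- `B` covers the remainder of `k` modulo `p`, and `2` compensates for `ρ ^ (k % p) ≥ 1 / 2`.
  refine ⟨2 * B, ρ, by positivity, hρ0, hρ1, fun k => ?_⟩
  have hr : k % p < p := Nat.mod_lt _ hp1
  have hBr : ‖T ^ (k % p)‖ ≤ B := Finset.single_le_sum (f := fun r => ‖T ^ r‖)
    (fun _ _ => norm_nonneg _) (Finset.mem_range.2 hr)
  have hmul : ∀ i : ℕ, ‖T ^ (p * i + k % p)‖ ≤ (1 / 2) ^ i * B := fun i => by
    induction i with
    | zero => simpa using hBr
    | succ i ih =>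
      have : p * (i + 1) + k % p = p + (p * i + k % p) := by ring
      rw [this, pow_add]
      calc _ ≤ ‖T ^ p‖ * ‖T ^ (p * i + k % p)‖ := norm_mul_le _ _
        _ ≤ 1 / 2 * ((1 / 2) ^ i * B) := mul_le_mul hp.le ih (norm_nonneg _) (by norm_num)
        _ = _ := by ring
  have hk := hmul (k / p)
  rw [Nat.div_add_mod] at hk
  have h1 : ρ ^ k = (1 / 2) ^ (k / p) * ρ ^ (k % p) := by
    rw [← hρp, ← pow_mul, ← pow_add, Nat.div_add_mod]
  have h2 : 1 / 2 ≤ ρ ^ (k % p) := hρp ▸ pow_le_pow_of_le_one hρ0.le hρ1.le hr.le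
  calc ‖T ^ k‖ ≤ (1 / 2) ^ (k / p) * B := hk
    _ = 2 * B * ((1 / 2) ^ (k / p) * (1 / 2)) := by ring
    _ ≤ 2 * B * ρ ^ k := by rw [h1]; gcongr

theorem tendsto_norm_pow_of_summable_apply {E : Type*} [NormedAddCommGroup E] [NormedSpace ℝ E]
    [FiniteDimensional ℝ E] {T : E →L[ℝ] E} (h : ∀ v, Summable fun k : ℕ => ‖(T ^ k) v‖) :
    Tendsto (fun k : ℕ => ‖T ^ k‖) atTop (𝓝 0) := by
  let b := Module.finBasis ℝ E
  obtain ⟨C, hC, hCb⟩ := b.exists_opNorm_le (F := E)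
  have h1 : Tendsto (fun k : ℕ => C * ∑ i, ‖(T ^ k) (b i)‖) atTop (𝓝 0) := by
    simpa using (tendsto_finsetSum Finset.univ
      fun i _ => (h (b i)).tendsto_atTop_zero).const_mul C
  refine squeeze_zero (fun _ => norm_nonneg _) (fun k => ?_) h1
  exact hCb (Finset.sum_nonneg fun _ _ => norm_nonneg _) fun i =>
    Finset.single_le_sum (f := fun i => ‖(T ^ k) (b i)‖) (fun _ _ => norm_nonneg _)
      (Finset.mem_univ i)

attribute [local instance] Matrix.linftyOpNormedRing Matrix.linftyOpNormedAlgebra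

/-- Gelfand's formula for the complexified matrix bounds the powers by `r ^ k` eventually, with `r <
1`. -/
theorem IsSchur.exists_summable_bound {n : ℕ} {A : Matrix (Fin n) (Fin n) ℝ} (hA : IsSchur A) :
    ∃ s : ℕ → ℝ, (∀ k, 0 ≤ s k) ∧ Summable s ∧ ∀ k v, ‖(A ^ k) *ᵥ v‖ ≤ s k * ‖v‖ := by
  rcases Nat.eq_zero_or_pos n with rfl | hn
  · exact ⟨0, fun _ => le_rfl, summable_zero, fun k v => by
      rw [Subsingleton.elim ((A ^ k) *ᵥ v) 0]; simp⟩
  have : Nonempty (Fin n) := ⟨⟨0, hn⟩⟩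
  set B : Matrix (Fin n) (Fin n) ℂ := A.map (fun t : ℝ => (t : ℂ)) with hB
  have hpow : ∀ k : ℕ, (A ^ k).map (fun t : ℝ => (t : ℂ)) = B ^ k := fun k =>
    Matrix.map_pow (f := Complex.ofRealHom) A k
  have hvec : ∀ k v, ‖(A ^ k) *ᵥ v‖ ≤ ‖B ^ k‖ * ‖v‖ := fun k v => by
    have h1 : ‖(A ^ k) *ᵥ v‖ = ‖(B ^ k) *ᵥ (fun i => ((v i : ℝ) : ℂ))‖ := by
      rw [← hpow]
      have : ((A ^ k).map (fun t : ℝ => (t : ℂ))) *ᵥ (fun i => ((v i : ℝ) : ℂ))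
          = fun i => ((((A ^ k) *ᵥ v) i : ℝ) : ℂ) := by
        ext i
        simp [Matrix.mulVec, dotProduct]
      rw [this]
      simp [Pi.norm_def]
    have h2 : ‖(fun i => ((v i : ℝ) : ℂ))‖ = ‖v‖ := by simp [Pi.norm_def]
    rw [h1, ← h2]
    exact Matrix.linfty_opNorm_mulVec _ _
  have hrad : spectralRadius ℂ B < (1 : NNReal) :=
    spectrum.spectralRadius_lt_of_forall_lt B fun z hz => hA z hz
  have hlim := spectrum.pow_nnnorm_pow_one_div_tendsto_nhds_spectralRadius B
  obtain ⟨r, hr, hr1⟩ := ENNReal.lt_iff_exists_nnreal_btwn.1 hrad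
  have hev : ∀ᶠ k : ℕ in atTop, ‖B ^ k‖ ≤ (r : ℝ) ^ k := by
    filter_upwards [hlim.eventually (gt_mem_nhds hr), eventually_ge_atTop 1] with k hk hk1
    have hk0 : (0 : ℝ) < k := by exact_mod_cast hk1
    have h := ENNReal.rpow_le_rpow hk.le hk0.le
    rw [← ENNReal.rpow_mul, one_div_mul_cancel hk0.ne', ENNReal.rpow_one, ENNReal.rpow_natCast] at h
    exact_mod_cast h
  refine ⟨fun k => ‖B ^ k‖, fun _ => norm_nonneg _, ?_, hvec⟩
  refine Summable.of_norm_bounded_eventually_nat (g := fun k => (r : ℝ) ^ k)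
    (summable_geometric_of_lt_one r.2 (by exact_mod_cast hr1)) ?_
  filter_upwards [hev] with k hk
  simpa using hk

/-- Variation of constants: the driven part is a convolution of two summable sequences. This passes
summability down the cascade. -/
theorem IsSchur.summable_norm {n : ℕ} {A : Matrix (Fin n) (Fin n) ℝ} (hA : IsSchur A)
    {x u : ℕ → Fin n → ℝ} (hx : ∀ k, x (k + 1) = A *ᵥ x k + u k)
    (hu : Summable fun k => ‖u k‖) : Summable fun k => ‖x k‖ := by
  obtain ⟨s, hs0, hs, hsA⟩ := hA.exists_summable_bound
  have hform : ∀ k, x (k + 1) = (A ^ (k + 1)) *ᵥ x 0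
      + ∑ j ∈ Finset.range (k + 1), (A ^ (k - j)) *ᵥ u j := fun k => by
    induction k with
    | zero => simp [hx]
    | succ k ih =>
      rw [hx (k + 1), ih, Matrix.mulVec_add, Matrix.mulVec_mulVec, ← pow_succ',
        Finset.sum_range_succ _ (k + 1), Matrix.mulVec_sum, add_assoc]
      congr 2
      · refine Finset.sum_congr rfl fun j hj => ?_
        rw [Matrix.mulVec_mulVec, ← pow_succ']
        congr 2
        have := Finset.mem_range.1 hj
        omega
      · simp
  have hconv := summable_norm_sum_mul_range_of_summable_norm (f := fun k => ‖u k‖) (g := s)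
    (by simpa using hu) (by simpa [abs_of_nonneg (hs0 _)] using hs)
  rw [← summable_nat_add_iff 1]
  refine Summable.of_nonneg_of_le (fun _ => norm_nonneg _) (fun k => ?_)
    ((((summable_nat_add_iff 1).2 hs).mul_right ‖x 0‖).add hconv)
  rw [hform]
  refine (norm_add_le _ _).trans (add_le_add (hsA _ _) ((norm_sum_le _ _).trans ?_))
  refine le_trans (Finset.sum_le_sum fun j _ => ?_) (Real.le_norm_self _)
  rw [mul_comm]
  exact hsA _ _

end PowerDecay

/-! ### Dini continuity along geometric sequences. -/

section Dini

variable {S : Type*} [PseudoMetricSpace S] {f : S → ℝ}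

theorem modulus_mono (f : S → ℝ) : Monotone (modulus f) := fun _ _ h =>
  iSup_mono fun _ => iSup_mono fun _ => iSup_mono' fun hd => ⟨hd.trans h, le_rfl⟩

theorem modulus_le_one (h0 : ∀ x, 0 ≤ f x) (h1 : ∀ x, f x ≤ 1) (t : ℝ) : modulus f t ≤ 1 := by
  refine iSup_le fun x => iSup_le fun y => iSup_le fun _ => ?_
  rw [edist_dist, ← ENNReal.ofReal_one]
  refine ENNReal.ofReal_le_ofReal ?_
  rw [Real.dist_eq, abs_le]
  constructor <;> linarith [h0 x, h1 x, h0 y, h1 y]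

theorem abs_sub_le_modulus {t : ℝ} (hf : modulus f t ≠ ∞) {x y : S} (h : dist x y ≤ t) :
    |f x - f y| ≤ (modulus f t).toReal := by
  have h1 : edist (f x) (f y) ≤ modulus f t :=
    le_iSup_of_le x (le_iSup_of_le y (le_iSup_of_le h le_rfl))
  have h2 := ENNReal.toReal_mono hf h1
  rwa [edist_dist, ENNReal.toReal_ofReal dist_nonneg, Real.dist_eq] at h2

/-- Integral test on the intervals between consecutive `ε * ρ ^ i`: by monotonicity each integral is
at least `1 - ρ` times the modulus at the left end. -/
theorem DiniContinuous.summable_modulus (hf : DiniContinuous f) (hm : ∀ t, modulus f t ≠ ∞)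
    {ρ : ℝ} (hρ0 : 0 < ρ) (hρ1 : ρ < 1) (t : ℝ) :
    Summable fun k : ℕ => (modulus f (t * ρ ^ k)).toReal := by
  obtain ⟨ε, hε, hint⟩ := hf
  let I : ℕ → Set ℝ := fun i => Set.Ioo (ε * ρ ^ (i + 1)) (ε * ρ ^ i)
  have hI : ∀ i, ENNReal.ofReal (1 - ρ) * modulus f (ε * ρ ^ (i + 1))
      ≤ ∫⁻ s in I i, modulus f s / ENNReal.ofReal s := fun i => by
    have hpos : 0 < ε * ρ ^ i := by positivity
    calc ENNReal.ofReal (1 - ρ) * modulus f (ε * ρ ^ (i + 1))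
        = ∫⁻ _ in I i, modulus f (ε * ρ ^ (i + 1)) / ENNReal.ofReal (ε * ρ ^ i) := by
          rw [setLIntegral_const, Real.volume_Ioo]
          have : ε * ρ ^ i - ε * ρ ^ (i + 1) = ε * ρ ^ i * (1 - ρ) := by ring
          rw [this, ENNReal.ofReal_mul hpos.le, ← mul_assoc, ENNReal.div_mul_cancel
            (by simpa using hpos) ENNReal.ofReal_ne_top, mul_comm]
      _ ≤ _ := setLIntegral_mono' measurableSet_Ioo fun s hs =>
          ENNReal.div_le_div (modulus_mono f hs.1.le) (ENNReal.ofReal_le_ofReal hs.2.le)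
  have hdisj : Pairwise (Function.onFun Disjoint I) := by
    refine (pairwise_disjoint_on I).2 fun i j hij => Set.disjoint_left.2 fun s hs hs' => ?_
    have : ε * ρ ^ j ≤ ε * ρ ^ (i + 1) :=
      mul_le_mul_of_nonneg_left (pow_le_pow_of_le_one hρ0.le hρ1.le hij) hε.le
    linarith [hs.1, hs'.2]
  have hsub : ⋃ i, I i ⊆ Set.Ioo 0 ε := Set.iUnion_subset fun i s hs =>
    ⟨lt_trans (by positivity) hs.1, hs.2.trans_le
      (mul_le_of_le_one_right hε.le (pow_le_one₀ hρ0.le hρ1.le))⟩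
  have hsum : ∑' i, modulus f (ε * ρ ^ (i + 1)) ≠ ∞ := by
    have h1 : ENNReal.ofReal (1 - ρ) * ∑' i, modulus f (ε * ρ ^ (i + 1)) < ∞ := by
      rw [← ENNReal.tsum_mul_left]
      calc _ ≤ ∑' i, ∫⁻ s in I i, modulus f s / ENNReal.ofReal s := ENNReal.tsum_le_tsum hI
        _ = ∫⁻ s in ⋃ i, I i, modulus f s / ENNReal.ofReal s :=
          (lintegral_iUnion (fun _ => measurableSet_Ioo) hdisj _).symm
        _ ≤ _ := lintegral_mono_set hsub
        _ < ∞ := hint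
    intro h
    rw [h, ENNReal.mul_top (by simpa using hρ1)] at h1
    exact h1.ne rfl
  have hsum' := ENNReal.summable_toReal hsum
  obtain ⟨j, hj⟩ : ∃ j : ℕ, t * ρ ^ j ≤ ε * ρ := by
    have : Tendsto (fun j : ℕ => t * ρ ^ j) atTop (𝓝 0) := by
      simpa using (tendsto_pow_atTop_nhds_zero_of_lt_one hρ0.le hρ1).const_mul t
    exact ((this.eventually (gt_mem_nhds (show 0 < ε * ρ by positivity))).exists).imp
      fun _ h => h.le
  rw [← summable_nat_add_iff j]
  refine Summable.of_nonneg_of_le (fun _ => ENNReal.toReal_nonneg) (fun k => ?_) hsum'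
  refine ENNReal.toReal_mono (hm _) (modulus_mono f ?_)
  calc t * ρ ^ (k + j) = t * ρ ^ j * ρ ^ k := by ring
    _ ≤ ε * ρ * ρ ^ k := mul_le_mul_of_nonneg_right hj (by positivity)
    _ = ε * ρ ^ (k + 1) := by ring

end Dini

/-! ### Estimates for the weights and the linear part of the loop. -/

theorem abs_prod_sub_prod_le {ι : Type*} (s : Finset ι) {a b : ι → ℝ} (ha0 : ∀ i, 0 ≤ a i)
    (ha1 : ∀ i, a i ≤ 1) (hb0 : ∀ i, 0 ≤ b i) (hb1 : ∀ i, b i ≤ 1) :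
    |∏ i ∈ s, a i - ∏ i ∈ s, b i| ≤ ∑ i ∈ s, |a i - b i| := by
  classical
  induction s using Finset.induction_on with
  | empty => simp
  | insert i s hi ih =>
    rw [Finset.prod_insert hi, Finset.prod_insert hi, Finset.sum_insert hi]
    have hA0 : 0 ≤ ∏ i ∈ s, a i := Finset.prod_nonneg fun i _ => ha0 i
    have hA1 : ∏ i ∈ s, a i ≤ 1 := Finset.prod_le_one (fun i _ => ha0 i) fun i _ => ha1 i
    calc _ = |(a i - b i) * ∏ i ∈ s, a i + b i * (∏ i ∈ s, a i - ∏ i ∈ s, b i)| := by ring_nf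
      _ ≤ |a i - b i| * ∏ i ∈ s, a i + b i * |∏ i ∈ s, a i - ∏ i ∈ s, b i| := by
        refine (abs_add_le _ _).trans_eq ?_
        rw [abs_mul, abs_mul, abs_of_nonneg hA0, abs_of_nonneg (hb0 i)]
      _ ≤ |a i - b i| + ∑ i ∈ s, |a i - b i| := add_le_add
        (mul_le_of_le_one_right (abs_nonneg _) hA1)
        ((mul_le_of_le_one_left (abs_nonneg _) (hb1 i)).trans ih)

theorem ProbFunctions.prob_le_one {Sig : Set ℝ} {w : ℕ} (p : ProbFunctions Sig w) (j : Fin w)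
    (s : Sig) : p.prob j s ≤ 1 :=
  p.sum_eq_one s ▸ Finset.single_le_sum (f := fun j => p.prob j s) (fun j _ => p.nonneg j s)
    (Finset.mem_univ j)

theorem ProbFunctions.modulus_ne_top {Sig : Set ℝ} {w : ℕ} (p : ProbFunctions Sig w) (j : Fin w)
    (t : ℝ) : modulus (p.prob j) t ≠ ∞ :=
  ((modulus_le_one (p.nonneg j) (p.prob_le_one j) t).trans_lt ENNReal.one_lt_top).ne

namespace FeedbackLoop

variable {Sig : Set ℝ} {N : ℕ} (L : FeedbackLoop Sig N)

theorem pow_mul_pow_le_weight {δ δ' : ℝ} (hδ : 0 < δ) (hδ' : 0 < δ')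
    (hpδ : ∀ i j s, δ ≤ (L.agent i).p.prob j s)
    (hpδ' : ∀ i l s, δ' ≤ (L.agent i).p'.prob l s) (m : L.Choice) (s : Sig) :
    δ ^ N * δ' ^ N ≤ L.weight m s := by
  have h1 : δ ^ N ≤ ∏ i, (L.agent i).p.prob (m.1 i) s := by
    simpa using Finset.prod_le_prod (s := Finset.univ) (fun _ _ => hδ.le)
      fun i _ => hpδ i (m.1 i) s
  have h2 : δ' ^ N ≤ ∏ i, (L.agent i).p'.prob (m.2 i) s := by
    simpa using Finset.prod_le_prod (s := Finset.univ) (fun _ _ => hδ'.le)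
      fun i _ => hpδ' i (m.2 i) s
  exact mul_le_mul h1 h2 (by positivity) (Finset.prod_nonneg fun _ _ => ProbFunctions.nonneg _ _ _)

/-- The sum of the moduli of continuity of all probability functions of all agents. -/
noncomputable def totalModulus (t : ℝ) : ℝ :=
  (∑ i, ∑ j, (modulus ((L.agent i).p.prob j) t).toReal)
    + ∑ i, ∑ l, (modulus ((L.agent i).p'.prob l) t).toReal

theorem totalModulus_nonneg (t : ℝ) : 0 ≤ L.totalModulus t :=
  add_nonneg (Finset.sum_nonneg fun _ _ => Finset.sum_nonneg fun _ _ => ENNReal.toReal_nonneg)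
    (Finset.sum_nonneg fun _ _ => Finset.sum_nonneg fun _ _ => ENNReal.toReal_nonneg)

theorem abs_weight_sub_le (m : L.Choice) {s s' : Sig} {t : ℝ} (h : dist s s' ≤ t) :
    |L.weight m s - L.weight m s'| ≤ L.totalModulus t := by
  have h1 := abs_prod_sub_prod_le Finset.univ
    (a := fun i => (L.agent i).p.prob (m.1 i) s) (b := fun i => (L.agent i).p.prob (m.1 i) s')
    (fun _ => ProbFunctions.nonneg _ _ _) (fun _ => ProbFunctions.prob_le_one _ _ _)
    (fun _ => ProbFunctions.nonneg _ _ _) (fun _ => ProbFunctions.prob_le_one _ _ _)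
  have h2 := abs_prod_sub_prod_le Finset.univ
    (a := fun i => (L.agent i).p'.prob (m.2 i) s) (b := fun i => (L.agent i).p'.prob (m.2 i) s')
    (fun _ => ProbFunctions.nonneg _ _ _) (fun _ => ProbFunctions.prob_le_one _ _ _)
    (fun _ => ProbFunctions.nonneg _ _ _) (fun _ => ProbFunctions.prob_le_one _ _ _)
  have hle : ∀ {w : Fin N → ℕ} (p : ∀ i, ProbFunctions Sig (w i)) (m : ∀ i, Fin (w i)),
      ∑ i, |(p i).prob (m i) s - (p i).prob (m i) s'|
        ≤ ∑ i, ∑ j, (modulus ((p i).prob j) t).toReal := fun p m =>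
    Finset.sum_le_sum fun i _ => (abs_sub_le_modulus ((p i).modulus_ne_top (m i) t) h).trans
      (Finset.single_le_sum (f := fun j => (modulus ((p i).prob j) t).toReal)
        (fun _ _ => ENNReal.toReal_nonneg) (Finset.mem_univ (m i)))
  have hA0 : 0 ≤ ∏ i, (L.agent i).p'.prob (m.2 i) s :=
    Finset.prod_nonneg fun _ _ => ProbFunctions.nonneg _ _ _
  have hA1 : ∏ i, (L.agent i).p'.prob (m.2 i) s ≤ 1 :=
    Finset.prod_le_one (fun _ _ => ProbFunctions.nonneg _ _ _)
      fun _ _ => ProbFunctions.prob_le_one _ _ _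
  have hB0 : 0 ≤ ∏ i, (L.agent i).p.prob (m.1 i) s' :=
    Finset.prod_nonneg fun _ _ => ProbFunctions.nonneg _ _ _
  have hB1 : ∏ i, (L.agent i).p.prob (m.1 i) s' ≤ 1 :=
    Finset.prod_le_one (fun _ _ => ProbFunctions.nonneg _ _ _)
      fun _ _ => ProbFunctions.prob_le_one _ _ _
  have h1' := h1.trans (hle (fun i => (L.agent i).p) m.1)
  have h2' := h2.trans (hle (fun i => (L.agent i).p') m.2)
  have key : ∀ {a b c d : ℝ}, 0 ≤ b → b ≤ 1 → 0 ≤ c → c ≤ 1 →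
      |a * b - c * d| ≤ |a - c| + |b - d| := fun {a b c d} hb0 hb1 hc0 hc1 => by
    calc |a * b - c * d| = |(a - c) * b + c * (b - d)| := by ring_nf
      _ ≤ |a - c| * b + c * |b - d| := by
        refine (abs_add_le _ _).trans_eq ?_
        rw [abs_mul, abs_mul, abs_of_nonneg hb0, abs_of_nonneg hc0]
      _ ≤ _ := add_le_add (mul_le_of_le_one_right (abs_nonneg _) hb1)
        (mul_le_of_le_one_left (abs_nonneg _) hc1)
  exact (key hA0 hA1 hB0 hB1).trans (add_le_add h1' h2')

theorem summable_totalModulus (hp : ∀ i j, DiniContinuous ((L.agent i).p.prob j))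
    (hp' : ∀ i l, DiniContinuous ((L.agent i).p'.prob l)) {ρ : ℝ} (hρ0 : 0 < ρ) (hρ1 : ρ < 1)
    (t : ℝ) : Summable fun k : ℕ => L.totalModulus (t * ρ ^ k) :=
  (summable_sum fun i _ => summable_sum fun j _ =>
    (hp i j).summable_modulus ((L.agent i).p.modulus_ne_top j) hρ0 hρ1 t).add
  (summable_sum fun i _ => summable_sum fun l _ =>
    (hp' i l).summable_modulus ((L.agent i).p'.modulus_ne_top l) hρ0 hρ1 t)

/-- The linear part of the loop dynamics; it does not depend on the choice of the inputs. -/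
noncomputable def linearPart : L.State →L[ℝ] L.State :=
  LinearMap.toContinuousLinearMap
    { toFun := fun ξ => (fun i => (L.agent i).A *ᵥ ξ.1 i,
        L.filter.A *ᵥ ξ.2.1 + (∑ i, (L.agent i).c ⬝ᵥ ξ.1 i) • L.filter.B,
        L.controller.A *ᵥ ξ.2.2 + (-(L.filter.C ⬝ᵥ ξ.2.1)) • L.controller.B)
      map_add' := fun ξ η => by
        refine Prod.ext ?_ (Prod.ext ?_ ?_)
        · funext i
          simp [Matrix.mulVec_add]
        · simp only [Prod.fst_add, Prod.snd_add, Pi.add_apply, Matrix.mulVec_add, dotProduct_add,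
            Finset.sum_add_distrib, add_smul]
          abel
        · simp only [Prod.snd_add, Prod.fst_add, Matrix.mulVec_add, dotProduct_add, neg_add,
            add_smul]
          abel
      map_smul' := fun r ξ => by
        refine Prod.ext ?_ (Prod.ext ?_ ?_)
        · funext i
          simp [Matrix.mulVec_smul]
        · simp [Matrix.mulVec_smul, dotProduct_smul, Finset.mul_sum, smul_smul]
        · simp [Matrix.mulVec_smul, dotProduct_smul, smul_smul] }

theorem linearPart_apply (ξ : L.State) :
    L.linearPart ξ = (fun i => (L.agent i).A *ᵥ ξ.1 i,
        L.filter.A *ᵥ ξ.2.1 + (∑ i, (L.agent i).c ⬝ᵥ ξ.1 i) • L.filter.B,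
        L.controller.A *ᵥ ξ.2.2 + (-(L.filter.C ⬝ᵥ ξ.2.1)) • L.controller.B) :=
  rfl

theorem step_eq_linearPart_add (m : L.Choice) (ξ : L.State) :
    L.step m ξ = L.linearPart ξ + L.step m 0 := by
  rw [linearPart_apply]
  refine Prod.ext ?_ (Prod.ext ?_ ?_)
  · funext i
    simp [step]
  · simp [step, output, Finset.sum_add_distrib, add_smul, add_assoc]
  · simp only [step, error, Prod.snd_add, Prod.snd_zero, Prod.fst_zero, Matrix.mulVec_zero,
      dotProduct_zero, zero_add, sub_zero]
    rw [add_assoc, ← add_smul]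
    congr 2
    ring

/-- Summability travels along the cascade: agents, then filter, then controller. -/
theorem summable_norm_linearPart_pow (hA : ∀ i, IsSchur (L.agent i).A)
    (hC : IsSchur L.controller.A) (hF : IsSchur L.filter.A) (ξ : L.State) :
    Summable fun k : ℕ => ‖(L.linearPart ^ k) ξ‖ := by
  let z : ℕ → L.State := fun k => (L.linearPart ^ k) ξ
  have hz : ∀ k, z (k + 1) = L.linearPart (z k) := fun k => by
    simp only [z, pow_succ']
    rfl
  have hdot : ∀ {n : ℕ} (c : Fin n → ℝ) {v : ℕ → Fin n → ℝ}, Summable (fun k => ‖v k‖) →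
      Summable fun k => |c ⬝ᵥ v k| := fun c v hv => by
    refine Summable.of_nonneg_of_le (fun _ => abs_nonneg _) (fun k => ?_)
      (hv.mul_left (∑ i, |c i|))
    rw [Finset.sum_mul]
    refine (Finset.abs_sum_le_sum_abs _ _).trans (Finset.sum_le_sum fun i _ => ?_)
    rw [abs_mul]
    exact mul_le_mul_of_nonneg_left (norm_le_pi_norm (v k) i) (abs_nonneg _)
  have h1 : ∀ i, Summable fun k => ‖(z k).1 i‖ := fun i =>
    (hA i).summable_norm (u := 0) (fun k => by simp [hz, linearPart_apply]) (by simp)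
  have h2 : Summable fun k => ‖(z k).2.1‖ := by
    refine hF.summable_norm (u := fun k => (∑ i, (L.agent i).c ⬝ᵥ (z k).1 i) • L.filter.B)
      (fun k => by simp [hz, linearPart_apply]) ?_
    simp only [norm_smul]
    refine Summable.mul_right _ (Summable.of_nonneg_of_le (fun _ => norm_nonneg _)
      (fun k => norm_sum_le _ _) (summable_sum fun i _ => ?_))
    exact hdot _ (h1 i)
  have h3 : Summable fun k => ‖(z k).2.2‖ := by
    refine hC.summable_norm (u := fun k => (-(L.filter.C ⬝ᵥ (z k).2.1)) • L.controller.B)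
      (fun k => by simp [hz, linearPart_apply]) ?_
    simp only [norm_smul, norm_neg]
    exact Summable.mul_right _ (hdot _ h2)
  refine Summable.of_nonneg_of_le (fun _ => norm_nonneg _) (fun k => ?_)
    (((summable_sum (s := Finset.univ) fun i _ => h1 i).add h2).add h3)
  have hs : 0 ≤ ∑ i, ‖(z k).1 i‖ := Finset.sum_nonneg fun _ _ => norm_nonneg _
  have h4 : ‖(z k).1‖ ≤ ∑ i, ‖(z k).1 i‖ := (pi_norm_le_iff_of_nonneg hs).2 fun i =>
    Finset.single_le_sum (f := fun i => ‖(z k).1 i‖) (fun _ _ => norm_nonneg _) (Finset.mem_univ i)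
  have h5 := norm_nonneg (z k).2.1
  have h6 := norm_nonneg (z k).2.2
  exact max_le (by linarith) (max_le (by linarith) (by linarith))

theorem exists_signal_lipschitz :
    ∃ S : ℝ, 0 ≤ S ∧ ∀ ξ η : L.State, dist (L.signal ξ) (L.signal η) ≤ S * dist ξ η := by
  let ℓ : L.State →ₗ[ℝ] ℝ :=
    { toFun := fun ξ => L.controller.C ⬝ᵥ ξ.2.2 - L.controller.D * (L.filter.C ⬝ᵥ ξ.2.1)
      map_add' := fun ξ η => by simp only [Prod.snd_add, Prod.fst_add, dotProduct_add]; ring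
      map_smul' := fun r ξ => by
        simp only [Prod.smul_snd, Prod.smul_fst, dotProduct_smul, smul_eq_mul, RingHom.id_apply]
        ring }
  refine ⟨‖LinearMap.toContinuousLinearMap ℓ‖, norm_nonneg _, fun ξ η => ?_⟩
  have h : L.signal ξ - L.signal η = LinearMap.toContinuousLinearMap ℓ (ξ - η) := by
    rw [map_sub]
    simp only [signal, error, LinearMap.coe_toContinuousLinearMap', LinearMap.coe_mk,
      AddHom.coe_mk, ℓ]
    ring
  rw [Real.dist_eq, h, dist_eq_norm]
  exact (LinearMap.toContinuousLinearMap ℓ).le_opNorm _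

theorem continuous_step (m : L.Choice) : Continuous (L.step m) := by
  unfold step output error dotProduct
  fun_prop

end FeedbackLoop
end Ensemble

/-! ### Assembly for the closed loop. -/

theorem theorem4 {Sig : Set ℝ} {N : ℕ} (L : Ensemble.FeedbackLoop Sig N)
    (hA : ∀ i, Ensemble.IsSchur (L.agent i).A)
    (hp : ∀ i j, Ensemble.DiniContinuous ((L.agent i).p.prob j))
    (hp' : ∀ i l, Ensemble.DiniContinuous ((L.agent i).p'.prob l))
    (δ δ' : ℝ) (hδ : 0 < δ) (hδ' : 0 < δ')
    (hpδ : ∀ i j s, δ ≤ (L.agent i).p.prob j s)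
    (hpδ' : ∀ i l s, δ' ≤ (L.agent i).p'.prob l s)
    (hC : Ensemble.IsSchur L.controller.A)
    (hF : Ensemble.IsSchur L.filter.A)
    (X : Set L.State) (hX : L.IsStateSpace X) :
    ∃ μ : ProbabilityMeasure X,
      Kernel.Invariant (L.transition hX) (μ : Measure X) ∧
      (∀ μ' : ProbabilityMeasure X,
        Kernel.Invariant (L.transition hX) (μ' : Measure X) → μ' = μ) ∧
      ∀ ν : ProbabilityMeasure X,
        Filter.Tendsto (Ensemble.lawAt (L.transition hX) ν) Filter.atTop (nhds μ) := by
  obtain ⟨C, ρ, hC0, hρ0, hρ1, hΛ⟩ := Ensemble.exists_norm_pow_le_geometric_of_tendsto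
    (Ensemble.tendsto_norm_pow_of_summable_apply (L.summable_norm_linearPart_pow hA hC hF))
  obtain ⟨S, hS0, hS⟩ := L.exists_signal_lipschitz
  let g : L.Choice → X → X := fun m ξ => ⟨L.step m ξ, hX.step_mem m ξ ξ.2⟩
  let q : L.Choice → X → ℝ := fun m ξ => L.weight m ⟨L.signal ξ, hX.signal_mem ξ ξ.2⟩
  have hg : ∀ m x, (g m x : L.State) = L.linearPart x + L.step m 0 := fun m x =>
    L.step_eq_linearPart_add m x
  have hgc : ∀ m, Continuous (g m) := fun m =>
    ((L.continuous_step m).comp continuous_subtype_val).subtype_mk _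
  have hq0 : ∀ m x, 0 ≤ q m x := fun m x => L.weight_nonneg m _
  have hq1 : ∀ x, ∑ m, q m x = 1 := fun x => L.sum_weight _
  have hqφ : ∀ m x y t, dist x y ≤ t → |q m x - q m y| ≤ L.totalModulus (S * t) :=
    fun m x y t h => L.abs_weight_sub_le m ((hS x y).trans (mul_le_mul_of_nonneg_left h hS0))
  have hφs : ∀ t, 0 ≤ t → Summable fun k : ℕ => L.totalModulus (S * (t * ρ ^ k)) := fun t _ => by
    simpa only [mul_assoc] using L.summable_totalModulus hp hp' hρ0 hρ1 (S * t)
  -- Summable terms tend to zero, so some radius `ρ ^ k` has modulus below `ε`.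
  have hqc : ∀ m, Continuous (q m) := fun m => by
    refine Metric.continuous_iff.2 fun x ε hε => ?_
    have h0 := (hφs 1 zero_le_one).tendsto_atTop_zero
    obtain ⟨k, hk⟩ := (h0.eventually (gt_mem_nhds hε)).exists
    exact ⟨1 * ρ ^ k, by positivity, fun y hy => (hqφ m y x _ hy.le).trans_lt hk⟩
  have hforget := fun (f : X → ℝ) (hf : Continuous f) (x y : X) =>
    Ensemble.tendsto_markovOp_iterate_sub hX.isClosed hg hC0 hρ0 hρ1 hΛ
      (show 0 < δ ^ N * δ' ^ N by positivity)
      (fun m x => L.pow_mul_pow_le_weight hδ hδ' hpδ hpδ' m _) hq1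
      (fun t => L.totalModulus_nonneg (S * t)) hqφ hφs hf x y
  obtain ⟨x₀, hx₀⟩ := hX.nonempty
  obtain ⟨R, K, -, hKc, hxK, -, hK, -⟩ := Ensemble.exists_isCompact_forward_invariant
    hX.isClosed hg hC0 hρ0 hρ1 hΛ ⟨x₀, hx₀⟩ ⟨x₀, hx₀⟩
  exact Ensemble.exists_unique_invariant_of_forget (fun _ => rfl) hq0 hq1 hqc hgc hKc ⟨_, hxK⟩ hK
    hforget
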